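/- Let $n\ge 1$ and $m\ge 0$ be integers, let $\mathcal D\subseteq\mathbb R^m$, and let $\Delta=(\Delta_1,\dots,\Delta_n)$ with each $\Delta_i(x,d)\in\mathbb R$ real analytic at every point $(x,d)$ of $[-1,1]^n\times\mathcal D$ (for example $\mathcal D=[-1,1]^m$). Let the external disturbance $d(t)$ be real analytic at every $t\in[-1,1]$, with $d(t)\in\mathcal D$ for $t\in[-1,1]$. For an integer $p\ge 0$ put $$\xi_p(t)=[T_0(t),T_1(t),\dots,T_p(t)]^{T}\in\mathbb R^{p+1},$$ where $T_k$ is the Chebyshev polynomial of the first kind of degree $k$, and let $B_p(x)\in\mathbb R^{(p+1)^{n+1}\times(p+1)}$ be the matrix whose row number $\sum_{i=1}^n k_i(p+1)^{i-1}+l\,(p+1)^n$ (rows numbered from $0$; $k_1,\dots,k_n,l\in\{0,\dots,p\}$) has the entry $T_{k_1}(x_1)\cdots T_{k_n}(x_n)$ in column $l$ (columns numbered $0,\dots,p$) and $0$ in all other columns. Then for every $\varepsilon'>0$ there are an integer $p=p(\varepsilon')\ge 0$ and a constant matrix $\Theta\in\mathbb R^{n\times s_1}$, where $s_1=(p+1)^{n+1}$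 and $s_2=p+1$, such that $$\sup_{(x,t)\in[-1,1]^{n+1}}\bigl\|\Delta(x,d(t))-\Theta\,B_p(x)\,\xi_p(t)\bigr\|_2\le\varepsilon',$$ and, for fixed $n$, $m$, $\Delta$, $d$, the integers $p(\varepsilon')$ can be chosen such that, as $\varepsilon'\to0^+$, $$s_1=O\bigl((\log(\sqrt n/\varepsilon'))^{n+1}\bigr),\qquad s_2=O\bigl(\log(\sqrt n/\varepsilon')\bigr).$$ -/

import Mathlib

open Set Filter Topology Asymptotics
open scoped Matrix

/-- The cube `[-1,1]^n` in `ℝ^n` (with its Euclidean norm). -/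
def unitCube (n : ℕ) : Set (EuclideanSpace ℝ (Fin n)) :=
  {x | ∀ i, x i ∈ Icc (-1 : ℝ) 1}

/-- The vector `ξ(t) = [T_0(t), …, T_p(t)]ᵀ` of Chebyshev polynomials of the first kind. -/
noncomputable def chebXi (p : ℕ) (t : ℝ) : Fin (p + 1) → ℝ :=
  fun l => (Polynomial.Chebyshev.T ℝ (l : ℤ)).eval t

/-- The product `T_{k_1}(x_1) ⋯ T_{k_n}(x_n)`. -/
noncomputable def chebProd {n p : ℕ} (k : Fin n → Fin (p + 1))
    (x : EuclideanSpace ℝ (Fin n)) : ℝ :=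
  ∏ i, (Polynomial.Chebyshev.T ℝ (k i : ℤ)).eval (x i)

/-- The block matrix `B(x)` of size `(p+1)^(n+1) × (p+1)`. The rows are numbered from `0`; the
row number `k_1 + k_2 (p+1) + ⋯ + k_n (p+1)^(n-1) + l (p+1)^n`, with all `k_i` and `l` in
`{0, …, p}`, has the entry `T_{k_1}(x_1) ⋯ T_{k_n}(x_n)` in column `l` and `0` elsewhere. So column
`l` is `Π(x)` (all the products, listed by `k`), preceded by `l (p+1)^n` zeros and followed by
zeros. -/
noncomputable def chebB (n p : ℕ) (x : EuclideanSpace ℝ (Fin n)) :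
    Matrix (Fin ((p + 1) ^ (n + 1))) (Fin (p + 1)) ℝ :=
  Matrix.of fun r l =>
    -- the `n + 1` digits of `r` in base `p + 1`, least significant first
    let digit : Fin (n + 1) → Fin (p + 1) := finFunctionFinEquiv.symm r
    if digit (Fin.last n) = l then chebProd (fun i : Fin n => digit i.castSucc) x else 0

/-! Substituting `d` makes each component of `Δ (x, d t)` a real analytic function `F` of the `n +
1` variables `(x, t)` on the cube, so the dimension `m` plays no role. Put `x_j = cos θ_j`: the
function becomes periodic and analytic on all of `ℝ^(n+1)`. Compactness of one period box gives a
single `B` with Cauchy bounds `B m! B^m` for the derivatives along every coordinate line.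
Integration by parts, optimized over `m`, turns these into exponentially decaying Fourier
coefficients. As `cos kθ = T_k (cos θ)`, every one-variable slice of `F` is within `O(σ^p)` of the
span of `T_0, …, T_p`, uniformly in the slice.

The variables are then joined one at a time by interpolation at Chebyshev nodes. This costs only a
factor polynomial in `p`, absorbed by a weaker rate `τ`. Over `n` components the error is at most
`√n M τ^p`, so `p` of order `log (√n / ε)` suffices. Finally, `Θ B(x) ξ(t)` is just a general tensor
Chebyshev expansion with the coefficients listed in `Θ`. -/

/-! ### Chebyshev interpolation and tensorization -/

open Polynomial in
/-- Interpolation at the zeros of `T_{p+1}`, written in the Chebyshev basis: it reproduces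
`T_0, …, T_p`, and its cardinal functions are bounded by `2`. -/
theorem exists_chebyshev_interpolation (p : ℕ) :
    ∃ (z : Fin (p + 1) → ℝ) (W : Fin (p + 1) → Fin (p + 1) → ℝ),
      (∀ i, z i ∈ Icc (-1 : ℝ) 1) ∧
      (∀ k l : Fin (p + 1), ∑ i, (Chebyshev.T ℝ (k : ℤ)).eval (z i) * W i l =
        if k = l then 1 else 0) ∧
      ∀ i, ∀ x ∈ Icc (-1 : ℝ) 1, |∑ l : Fin (p + 1), W i l * (Chebyshev.T ℝ (l : ℤ)).eval x| ≤ 2 := by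
  set z : ℕ → ℝ := fun i => Real.cos ((2 * i + 1) / (2 * ((p + 1 : ℕ) : ℝ)) * Real.pi) with hz
  have hzm (i : ℕ) : z i ∈ Icc (-1 : ℝ) 1 := ⟨Real.neg_one_le_cos _, Real.cos_le_one _⟩
  -- `1 / w l` is the sum of `T_l ^ 2` over the nodes, so `w l * T_l (z i)` is dual to the `T_k` by
  -- discrete orthogonality.
  set w : ℕ → ℝ := fun l => (if l = 0 then 1 else 2) / ((p + 1 : ℕ) : ℝ) with hw
  have hM : (0 : ℝ) < ((p + 1 : ℕ) : ℝ) := by positivity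
  have hT0 : ∑ i ∈ Finset.range (p + 1), (Chebyshev.T ℝ 0).eval (z i) = (p + 1 : ℕ) := by simp
  -- The node sum can be nonzero only if `2 (p + 1)` divides `k`; the indices `k ± l` used below
  -- have absolute value at most `2 p`.
  have hT (k : ℤ) (h0 : k ≠ 0) (hk : |k| < 2 * (p + 1 : ℕ)) :
      ∑ i ∈ Finset.range (p + 1), (Chebyshev.T ℝ k).eval (z i) = 0 := by
    have := Chebyshev.sumZeroes_T_of_not_dvd (n := p + 1) (k := k)
      (fun hd => h0 (Int.eq_zero_of_abs_lt_dvd hd hk))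
    rw [Chebyshev.sumZeroes] at this
    exact (mul_eq_zero.1 this).resolve_left (by positivity)
  have hprod (k l : ℕ) : 2 * ∑ i ∈ Finset.range (p + 1),
      (Chebyshev.T ℝ (k : ℤ)).eval (z i) * (Chebyshev.T ℝ (l : ℤ)).eval (z i) =
      ∑ i ∈ Finset.range (p + 1), (Chebyshev.T ℝ ((k : ℤ) + l)).eval (z i) +
      ∑ i ∈ Finset.range (p + 1), (Chebyshev.T ℝ ((k : ℤ) - l)).eval (z i) := by
    rw [Finset.mul_sum, ← Finset.sum_add_distrib]
    refine Finset.sum_congr rfl fun i _ => ?_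
    have := congrArg (Polynomial.eval (z i)) (Chebyshev.T_mul_T ℝ (k : ℤ) l)
    simp only [eval_mul, eval_add, eval_ofNat] at this
    linarith
  refine ⟨fun i => z i, fun i l => w l * (Chebyshev.T ℝ (l : ℤ)).eval (z i), fun i => hzm i,
    fun k l => ?_, fun i x hx => ?_⟩
  · have h1 : ∑ i : Fin (p + 1), (Chebyshev.T ℝ (k : ℤ)).eval (z i) *
        (w l * (Chebyshev.T ℝ (l : ℤ)).eval (z i)) = w l * ∑ i ∈ Finset.range (p + 1),
        (Chebyshev.T ℝ (k : ℤ)).eval (z i) * (Chebyshev.T ℝ (l : ℤ)).eval (z i) := by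
      rw [Finset.sum_range, Finset.mul_sum]
      exact Finset.sum_congr rfl fun i _ => by ring
    rw [h1]
    have h2 := hprod k l
    have hkp := k.2
    have hlp := l.2
    split_ifs with hkl
    · subst hkl
      rw [sub_self, hT0] at h2
      by_cases hk0 : (k : ℕ) = 0
      · simp only [hk0, Nat.cast_zero, add_zero] at h2 ⊢
        rw [hT0] at h2
        rw [← two_mul] at h2
        rw [mul_left_cancel₀ two_ne_zero h2, hw]
        simp only [if_true]
        field_simp
      · rw [hT _ (by omega) (by rw [abs_of_nonneg (by positivity)]; push_cast; omega)] at h2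
        simp only [hw, hk0, if_false]
        rw [div_mul_eq_mul_div, h2, zero_add, div_self hM.ne']
    · have hkl' : (k : ℕ) ≠ l := fun h => hkl (Fin.ext h)
      rw [hT _ (by omega) (by rw [abs_of_nonneg (by positivity)]; push_cast; omega),
        hT _ (by omega) (by rw [abs_lt]; push_cast; omega)] at h2
      rw [show ∑ i ∈ Finset.range (p + 1), (Chebyshev.T ℝ (k : ℤ)).eval (z i) *
        (Chebyshev.T ℝ (l : ℤ)).eval (z i) = 0 by linarith, mul_zero]
  · have hb (y : ℝ) (hy : y ∈ Icc (-1 : ℝ) 1) (l : ℤ) : |(Chebyshev.T ℝ l).eval y| ≤ 1 :=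
      Chebyshev.abs_eval_T_real_le_one l (abs_le.2 hy)
    calc _ ≤ ∑ l : Fin (p + 1), |w l * (Chebyshev.T ℝ (l : ℤ)).eval (z i) *
          (Chebyshev.T ℝ (l : ℤ)).eval x| := Finset.abs_sum_le_sum_abs _ _
      _ ≤ ∑ l : Fin (p + 1), 2 / ((p + 1 : ℕ) : ℝ) := by
        refine Finset.sum_le_sum fun l _ => ?_
        have hwl : |w l| ≤ 2 / ((p + 1 : ℕ) : ℝ) := by
          rw [hw, abs_of_nonneg (by positivity)]
          dsimp only
          gcongr
          split_ifs <;> norm_num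
        rw [abs_mul, abs_mul]
        calc _ ≤ 2 / ((p + 1 : ℕ) : ℝ) * 1 * 1 := by
              gcongr
              · exact hb _ (hzm i) _
              · exact hb _ hx _
          _ = _ := by ring
      _ = 2 := by
        rw [Finset.sum_const, Finset.card_univ, Fintype.card_fin, nsmul_eq_mul]
        field_simp

open Polynomial in
/-- If all one-dimensional slices of `F` on the cube are within `η` of the span of
`T_0, …, T_p`, then `F` is close to the span of their tensor products. -/
theorem exists_chebyshev_tensor_approx (p : ℕ) (η : ℝ) (hη : 0 ≤ η) :
    ∀ (N : ℕ) (F : (Fin N → ℝ) → ℝ),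
      (∀ (j : Fin N) (y : Fin N → ℝ), (∀ i, y i ∈ Icc (-1 : ℝ) 1) → ∃ a : Fin (p + 1) → ℝ,
        ∀ s ∈ Icc (-1 : ℝ) 1, |F (Function.update y j s) -
          ∑ k : Fin (p + 1), a k * (Chebyshev.T ℝ (k : ℤ)).eval s| ≤ η) →
      ∃ c : (Fin N → Fin (p + 1)) → ℝ, ∀ y : Fin N → ℝ, (∀ i, y i ∈ Icc (-1 : ℝ) 1) →
        |F y - ∑ k, c k * ∏ j, (Chebyshev.T ℝ (k j : ℤ)).eval (y j)| ≤
          N * (2 * p + 3 : ℝ) ^ N * η := by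
  obtain ⟨z, W, hz, hW, hL⟩ := exists_chebyshev_interpolation p
  intro N
  induction N with
  | zero =>
    intro F _
    refine ⟨fun _ => F 0, fun y _ => ?_⟩
    simp [Subsingleton.elim y 0]
  | succ N ih =>
    intro F hF
    have key (i : Fin (p + 1)) := ih (fun y => F (Fin.cons (z i) y)) (fun j y hy => by
      obtain ⟨a, ha⟩ := hF j.succ (Fin.cons (z i) y) (Fin.cases (by simpa using hz i) (by simpa using hy))
      refine ⟨a, fun s hs => ?_⟩
      have := ha s hs
      rwa [← Fin.cons_update] at this)
    choose c hc using key
    -- Interpolate, in the first variable, the inductive approximants of the slices at the nodes `z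
    -- i`.
    refine ⟨fun k => ∑ i, W i (k 0) * c i (Fin.tail k), fun y hy => ?_⟩
    set E : ℝ := N * (2 * p + 3 : ℝ) ^ N * η with hE
    set y' := Fin.tail y with hy'
    have hy'm : ∀ i, y' i ∈ Icc (-1 : ℝ) 1 := fun i => hy i.succ
    set Q : Fin (p + 1) → ℝ := fun i => ∑ k, c i k * ∏ j, (Chebyshev.T ℝ (k j : ℤ)).eval (y' j) with hQ
    set ℓ : Fin (p + 1) → ℝ := fun i => ∑ l : Fin (p + 1), W i l * (Chebyshev.T ℝ (l : ℤ)).eval (y 0) with hℓ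
    have hsum : ∑ k : Fin (N + 1) → Fin (p + 1), (∑ i, W i (k 0) * c i (Fin.tail k)) *
        ∏ j, (Chebyshev.T ℝ (k j : ℤ)).eval (y j) = ∑ i, ℓ i * Q i := by
      rw [← (Fin.consEquiv fun _ => Fin (p + 1)).sum_comp, Fintype.sum_prod_type]
      simp only [Fin.consEquiv_apply, Fin.cons_zero, Fin.prod_univ_succ, Fin.cons_succ, hℓ, hQ,
        Finset.sum_mul_sum]
      symm
      rw [Finset.sum_comm]
      refine Finset.sum_congr rfl fun l _ => ?_
      rw [Finset.sum_comm]
      refine Finset.sum_congr rfl fun k _ => ?_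
      rw [Finset.sum_mul]
      refine Finset.sum_congr rfl fun i _ => ?_
      rw [show Fin.tail ((Fin.consEquiv fun _ => Fin (p + 1)) (l, k)) = k from rfl]
      simp only [hy', Fin.tail]
      ring
    obtain ⟨a, ha⟩ := hF 0 y hy
    have hcons (s : ℝ) : Function.update y 0 s = Fin.cons s y' := by
      rw [← Fin.cons_self_tail y, Fin.update_cons_zero]
    simp only [hcons] at ha
    -- Interpolation reproduces the approximant of the slice of `F` through `y`, so only the
    -- differences at the nodes are amplified.
    have hrep (q : Fin (p + 1) → ℝ) (hq : ∀ i, q i = ∑ k : Fin (p + 1), a k * (Chebyshev.T ℝ (k : ℤ)).eval (z i)) :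
        ∑ i, ℓ i * q i = ∑ k : Fin (p + 1), a k * (Chebyshev.T ℝ (k : ℤ)).eval (y 0) := by
      calc ∑ i, ℓ i * q i = ∑ k : Fin (p + 1), ∑ l : Fin (p + 1), a k * (Chebyshev.T ℝ (l : ℤ)).eval (y 0) *
            ∑ i, (Chebyshev.T ℝ (k : ℤ)).eval (z i) * W i l := by
            simp only [hq, hℓ, Finset.sum_mul, Finset.mul_sum]
            rw [Finset.sum_comm]
            refine Finset.sum_congr rfl fun k _ => ?_
            rw [Finset.sum_comm]
            exact Finset.sum_congr rfl fun l _ => Finset.sum_congr rfl fun i _ => by ring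
        _ = _ := by simp [hW]
    set q : Fin (p + 1) → ℝ := fun i => ∑ k : Fin (p + 1), a k * (Chebyshev.T ℝ (k : ℤ)).eval (z i) with hq
    have hFy : F y = F (Fin.cons (y 0) y') := by rw [hy', Fin.cons_self_tail]
    have e1 := ha (y 0) (hy 0)
    rw [← hrep q (fun _ => rfl), ← hFy] at e1
    -- `2 (p + 1)` is a crude Lebesgue constant; at a node both `q i` and `Q i` are compared with
    -- the value of `F`.
    have e2 : |∑ i, ℓ i * q i - ∑ i, ℓ i * Q i| ≤ (p + 1) * (2 * (η + E)) := by
      rw [← Finset.sum_sub_distrib]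
      calc _ ≤ ∑ i, |ℓ i * q i - ℓ i * Q i| := Finset.abs_sum_le_sum_abs _ _
        _ ≤ ∑ i : Fin (p + 1), 2 * (η + E) := by
          refine Finset.sum_le_sum fun i _ => ?_
          rw [← mul_sub, abs_mul]
          have h1 := ha (z i) (hz i)
          have h2 := hc i y' hy'm
          have h3 : |q i - Q i| ≤ η + E := by
            rw [abs_le] at h1 h2 ⊢
            constructor <;> linarith [h1.1, h1.2, h2.1, h2.2]
          exact mul_le_mul (hL i _ (hy 0)) h3 (abs_nonneg _) (by norm_num)
        _ = _ := by simp
    rw [hsum]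
    have hpow : (1 : ℝ) ≤ (2 * p + 3 : ℝ) ^ N := one_le_pow₀ (by linarith [(Nat.cast_nonneg p : (0 : ℝ) ≤ p)])
    have hp0 : (0 : ℝ) ≤ p := Nat.cast_nonneg p
    calc _ ≤ |F y - ∑ i, ℓ i * q i| + |∑ i, ℓ i * q i - ∑ i, ℓ i * Q i| := abs_sub_le _ _ _
      _ ≤ η + (p + 1) * (2 * (η + E)) := add_le_add e1 e2
      _ = (2 * p + 3) * η * 1 + (2 * p + 2) * E := by ring
      _ ≤ (2 * p + 3) * η * (2 * p + 3 : ℝ) ^ N + (2 * p + 3) * E := by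
        have : 0 ≤ E := by positivity
        gcongr
        norm_num
      _ = _ := by rw [hE]; push_cast; ring

/-! ### Fourier decay and approximation in one variable -/

/-- Integrating by parts `m` times bounds the Fourier coefficients of a smooth periodic function. -/
theorem norm_fourierCoeffOn_mul_pow_le {φ : ℕ → ℝ → ℝ}
    (hder : ∀ m θ, HasDerivAt (φ m) (φ (m + 1) θ) θ)
    (hper : ∀ m, φ m (2 * Real.pi) = φ m 0) {B : ℕ → ℝ}
    (hB : ∀ m, ∀ θ ∈ Icc 0 (2 * Real.pi), |φ m θ| ≤ B m) (n : ℤ) (m : ℕ) :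
    ∀ j, ‖fourierCoeffOn Real.two_pi_pos (fun θ => (φ j θ : ℂ)) n‖ * |(n : ℝ)| ^ m ≤ B (j + m) := by
  have hcont (m : ℕ) : Continuous (φ m) :=
    continuous_iff_continuousAt.2 fun θ => (hder m θ).continuousAt
  induction m with
  | zero =>
    intro j
    rw [fourierCoeffOn_eq_integral, pow_zero, mul_one, norm_smul]
    have h1 : ‖∫ x in (0 : ℝ)..(2 * Real.pi), fourier (-n) (x : AddCircle (2 * Real.pi - 0)) •
        (φ j x : ℂ)‖ ≤ B j * |2 * Real.pi - 0| := by
      refine intervalIntegral.norm_integral_le_of_norm_le_const fun x hx => ?_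
      rw [uIoc_of_le Real.two_pi_pos.le] at hx
      rw [norm_smul, fourier_apply, Circle.norm_coe, one_mul, Complex.norm_real]
      exact hB j x ⟨hx.1.le, hx.2⟩
    rw [abs_of_pos (by simpa using Real.two_pi_pos)] at h1
    have h2 : 0 < 2 * Real.pi - 0 := by simpa using Real.two_pi_pos
    rw [norm_div, norm_one, Real.norm_of_nonneg h2.le, one_div_mul_eq_div, div_le_iff₀ h2]
    exact h1
  | succ m ih =>
    intro j
    by_cases hn : n = 0
    · subst hn
      have : 0 ≤ B (j + (m + 1)) := (abs_nonneg _).trans (hB _ 0 ⟨le_rfl, Real.two_pi_pos.le⟩)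
      simpa using this
    · have hn' : (n : ℝ) ≠ 0 := by exact_mod_cast hn
      have h := fourierCoeffOn_of_hasDerivAt Real.two_pi_pos hn
        (f := fun θ => (φ j θ : ℂ)) (f' := fun θ => (φ (j + 1) θ : ℂ))
        (fun x _ => (hder j x).ofReal_comp)
        ((Complex.continuous_ofReal.comp (hcont _)).intervalIntegrable _ _)
      -- Periodicity kills the boundary term, so each derivative is worth exactly one factor `|n|`.
      have h2 : ‖fourierCoeffOn Real.two_pi_pos (fun θ => (φ j θ : ℂ)) n‖ * |(n : ℝ)| =
          ‖fourierCoeffOn Real.two_pi_pos (fun θ => (φ (j + 1) θ : ℂ)) n‖ := by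
        rw [h, hper j]
        simp only [sub_self, mul_zero, zero_sub, norm_mul, norm_neg, norm_div, norm_one,
          Complex.norm_I, Complex.norm_intCast, Complex.ofReal_zero, sub_zero]
        simp only [Complex.norm_real, Complex.norm_ofNat, Complex.ofReal_mul, Complex.ofReal_ofNat,
          norm_mul, Real.norm_of_nonneg Real.pi_pos.le]
        have := Real.pi_pos
        have : |(n : ℝ)| ≠ 0 := abs_ne_zero.2 hn'
        field_simp
      calc _ = ‖fourierCoeffOn Real.two_pi_pos (fun θ => (φ j θ : ℂ)) n‖ * |(n : ℝ)| * |(n : ℝ)| ^ m := by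
            ring
        _ ≤ B (j + 1 + m) := by rw [h2]; exact ih (j + 1)
        _ = _ := by congr 1; ring

/-- Optimizing the bound `C m! R^m / k^m` over `m` gives exponential decay in `k`. -/
theorem exists_exponential_decay (R : ℝ) (hR : 0 < R) :
    ∃ σ ∈ Ioo (0 : ℝ) 1, ∀ (C a : ℝ) (k : ℕ), 0 ≤ C →
      (∀ m : ℕ, a * (k : ℝ) ^ m ≤ C * m.factorial * R ^ m) → a ≤ 2 * C * (σ ^ k * σ ^ k) := by
  set σ : ℝ := (1 / 2 : ℝ) ^ (1 / (4 * R)) with hσ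
  have h0 : 0 < σ := by positivity
  refine ⟨σ, ⟨h0, Real.rpow_lt_one (by norm_num) (by norm_num) (by positivity)⟩,
    fun C a k hC h => ?_⟩
  have hσk : σ ^ k * σ ^ k = (1 / 2 : ℝ) ^ ((k : ℝ) / (2 * R)) := by
    rw [← pow_add, hσ, ← Real.rpow_natCast, ← Real.rpow_mul (by norm_num)]
    congr 1
    push_cast
    field_simp
    ring
  -- With `m R ≤ k / 2` and `m! ≤ m ^ m`, the bound drops to `C / 2 ^ m`; rounding down costs the
  -- factor `2`.
  set m := ⌊(k : ℝ) / (2 * R)⌋₊ with hm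
  have hm1 : (m : ℝ) ≤ (k : ℝ) / (2 * R) := Nat.floor_le (by positivity)
  have hm2 : (k : ℝ) / (2 * R) < m + 1 := Nat.lt_floor_add_one _
  rw [hσk]
  have h3 : (1 / 2 : ℝ) ^ m ≤ 2 * (1 / 2 : ℝ) ^ ((k : ℝ) / (2 * R)) := by
    have := Real.rpow_le_rpow_of_exponent_ge (x := 1 / 2) (by norm_num) (by norm_num) hm2.le
    rw [Real.rpow_add (by norm_num), Real.rpow_natCast, Real.rpow_one] at this
    linarith
  have h4 : a ≤ C * (1 / 2 : ℝ) ^ m := by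
    rcases Nat.eq_zero_or_pos k with hk | hk
    · have : m = 0 := by rw [hm, hk]; simp
      simpa [this] using h 0
    · have hk' : (0 : ℝ) < k := by exact_mod_cast hk
      have hmR : (m : ℝ) * R ≤ k * (1 / 2) := by
        rw [le_div_iff₀ (by positivity)] at hm1
        linarith
      have h5 := h m
      rw [← le_div_iff₀ (by positivity)] at h5
      refine h5.trans ?_
      rw [div_le_iff₀ (by positivity), mul_assoc, mul_assoc]
      refine mul_le_mul_of_nonneg_left ?_ hC
      calc (m.factorial : ℝ) * R ^ m ≤ (m : ℝ) ^ m * R ^ m := by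
            gcongr
            exact_mod_cast Nat.factorial_le_pow m
        _ = (m * R) ^ m := by rw [mul_pow]
        _ ≤ (k * (1 / 2)) ^ m := by gcongr
        _ = _ := by rw [mul_pow]; ring
  calc a ≤ _ := h4
    _ ≤ C * (2 * (1 / 2 : ℝ) ^ ((k : ℝ) / (2 * R))) := by gcongr
    _ = _ := by ring

/-- A cosine series with coefficients `O(σ^{2|n|})` is approximated at rate `σ^p` by
Chebyshev expansions of degree `p`. -/
theorem exists_chebyshev_approx_of_hasSum {σ : ℝ} (hσ : σ ∈ Ioo (0 : ℝ) 1) {D : ℝ} (hD : 0 ≤ D)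
    {h : ℝ → ℝ} {a : ℤ → ℝ} (ha : ∀ n, |a n| ≤ D * (σ ^ n.natAbs * σ ^ n.natAbs))
    (hs : ∀ θ : ℝ, HasSum (fun n : ℤ => a n * Real.cos (n * θ)) (h (Real.cos θ))) (p : ℕ) :
    ∃ b : Fin (p + 1) → ℝ, ∀ s ∈ Icc (-1 : ℝ) 1,
      |h s - ∑ k : Fin (p + 1), b k * (Polynomial.Chebyshev.T ℝ (k : ℤ)).eval s| ≤
        (D * ∑' n : ℤ, σ ^ n.natAbs) * σ ^ p := by
  set S : Finset ℤ := Finset.Icc (-(p : ℤ)) p with hS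
  have hSm (n : ℤ) : n ∈ S ↔ n.natAbs < p + 1 := by rw [hS, Finset.mem_Icc]; omega
  -- The frequencies `k` and `-k` give the same cosine, hence the same `T_k`.
  refine ⟨fun k => ∑ n ∈ S with n.natAbs = (k : ℕ), a n, fun s hs1 => ?_⟩
  set θ := Real.arccos s with hθ
  have hc : Real.cos θ = s := Real.cos_arccos hs1.1 hs1.2
  have hfin : ∑ k : Fin (p + 1), (∑ n ∈ S with n.natAbs = (k : ℕ), a n) *
      (Polynomial.Chebyshev.T ℝ (k : ℤ)).eval s = ∑ n ∈ S, a n * Real.cos (n * θ) := by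
    rw [← Finset.sum_range (fun k : ℕ => (∑ n ∈ S with n.natAbs = k, a n) *
      (Polynomial.Chebyshev.T ℝ (k : ℤ)).eval s)]
    rw [← Finset.sum_fiberwise_of_maps_to (g := Int.natAbs) (t := Finset.range (p + 1))
      (fun n hn => Finset.mem_range.2 ((hSm n).1 hn))]
    refine Finset.sum_congr rfl fun k _ => ?_
    rw [Finset.sum_mul]
    refine Finset.sum_congr rfl fun n hn => ?_
    rw [← (Finset.mem_filter.1 hn).2, ← hc, Polynomial.Chebyshev.T_natAbs, Polynomial.Chebyshev.T_real_cos]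
  rw [hfin]
  have hsum : Summable fun n : ℤ => σ ^ n.natAbs := by
    have := summable_geometric_of_lt_one hσ.1.le hσ.2
    refine Summable.of_nat_of_neg ?_ ?_ <;> simpa using this
  have h1 := (hs θ).sub (hasSum_sum_of_ne_finset_zero (s := S)
    (f := fun n => if n ∈ S then a n * Real.cos (n * θ) else 0) (fun n hn => if_neg hn))
  rw [hc, Finset.sum_congr rfl (fun n hn => if_pos hn)] at h1
  rw [← h1.tsum_eq, ← tsum_mul_left, ← tsum_mul_right, ← Real.norm_eq_abs]
  refine tsum_of_norm_bounded ((hsum.mul_left D).mul_right (σ ^ p)).hasSum fun n => ?_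
  have hσ0 := hσ.1
  by_cases hn : n ∈ S
  · simp only [if_pos hn, sub_self, norm_zero]
    positivity
  · simp only [if_neg hn, sub_zero, norm_mul, Real.norm_eq_abs]
    calc _ ≤ D * (σ ^ n.natAbs * σ ^ n.natAbs) * 1 :=
          mul_le_mul (ha n) (Real.abs_cos_le_one _) (abs_nonneg _) (by positivity)
      -- Outside `S` one factor `σ ^ |n|` gives the rate `σ ^ p`; the other keeps the tail summable.
      _ ≤ D * (σ ^ n.natAbs * σ ^ p) * 1 := by
        have : p ≤ n.natAbs := by have := mt (hSm n).2 hn; omega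
        have := pow_le_pow_of_le_one hσ0.le hσ.2.le this
        gcongr
      _ = _ := by ring

/-- If the derivatives of `θ ↦ h (cos θ)` satisfy Cauchy-type bounds, then `h` is approximated
exponentially fast by Chebyshev expansions, uniformly in `h`. -/
theorem exists_chebyshev_approx_of_deriv_bound (R : ℝ) (hR : 0 < R) :
    ∃ σ ∈ Ioo (0 : ℝ) 1, ∃ A : ℝ, 0 ≤ A ∧ ∀ (C : ℝ) (h : ℝ → ℝ) (φ : ℕ → ℝ → ℝ),
      (∀ θ, φ 0 θ = h (Real.cos θ)) → (∀ m θ, HasDerivAt (φ m) (φ (m + 1) θ) θ) →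
      (∀ m, ∀ θ ∈ Icc 0 (2 * Real.pi), |φ m θ| ≤ C * m.factorial * R ^ m) →
      ∀ p : ℕ, ∃ b : Fin (p + 1) → ℝ, ∀ s ∈ Icc (-1 : ℝ) 1,
        |h s - ∑ k : Fin (p + 1), b k * (Polynomial.Chebyshev.T ℝ (k : ℤ)).eval s| ≤
          C * A * σ ^ p := by
  obtain ⟨σ, hσ, hdec⟩ := exists_exponential_decay R hR
  have hσ0 := hσ.1
  refine ⟨σ, hσ, 2 * ∑' n : ℤ, σ ^ n.natAbs,
    mul_nonneg zero_le_two (tsum_nonneg fun _ => by positivity), fun C h φ h0 hder hb p => ?_⟩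
  have hC : 0 ≤ C := by
    have := (abs_nonneg _).trans (hb 0 0 ⟨le_rfl, Real.two_pi_pos.le⟩)
    simpa using this
  have hper (m : ℕ) : Function.Periodic (φ m) (2 * Real.pi) := by
    induction m with
    | zero => intro θ; rw [h0, h0, Real.cos_add_two_pi]
    | succ m ih =>
      intro θ
      have h1 := (hder m (θ + 2 * Real.pi)).comp_add_const θ (2 * Real.pi)
      rw [show (fun x => φ m (x + 2 * Real.pi)) = φ m from funext ih] at h1
      exact h1.unique (hder m θ)
  have hcont : Continuous (φ 0) := continuous_iff_continuousAt.2 fun θ => (hder 0 θ).continuousAt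
  set α : ℤ → ℂ := fun n => fourierCoeffOn Real.two_pi_pos (fun θ => (φ 0 θ : ℂ)) n with hα
  have hαb (n : ℤ) : ‖α n‖ ≤ 2 * C * (σ ^ n.natAbs * σ ^ n.natAbs) := by
    refine hdec C _ n.natAbs hC fun m => ?_
    have := norm_fourierCoeffOn_mul_pow_le hder (fun m => by simpa using hper m 0) hb n m 0
    rw [zero_add] at this
    rwa [Nat.cast_natAbs, Int.cast_abs]
  have hsum : Summable fun n : ℤ => 2 * C * (σ ^ n.natAbs * σ ^ n.natAbs) := by
    have : Summable fun n : ℕ => σ ^ n * σ ^ n := by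
      simp_rw [← mul_pow]
      exact summable_geometric_of_lt_one (by positivity)
        (by nlinarith [hσ.2])
    refine Summable.mul_left _ (Summable.of_nat_of_neg ?_ ?_) <;> simpa using this
  have : Fact (0 < 2 * Real.pi) := ⟨Real.two_pi_pos⟩
  have hperC : Function.Periodic (fun θ => (φ 0 θ : ℂ)) (2 * Real.pi) := fun θ => by
    simp only [hper 0 θ]
  set f : C(AddCircle (2 * Real.pi), ℂ) := ⟨hperC.lift,
    continuous_coinduced_dom.2 (Complex.continuous_ofReal.comp hcont)⟩ with hf
  have hfα : fourierCoeff f = α := by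
    funext n
    rw [hα]
    dsimp only
    rw [fourierCoeffOn_eq_integral, fourierCoeff_eq_intervalIntegral _ _ 0]
    simp only [sub_zero, zero_add, fourier_coe_apply]
    rfl
  have hser (θ : ℝ) : HasSum (fun n : ℤ => α n * Complex.exp (n * θ * Complex.I))
      (h (Real.cos θ) : ℂ) := by
    have h1 := has_pointwise_sum_fourier_series_of_summable (f := f)
      (by rw [hfα]; exact Summable.of_norm_bounded hsum hαb) (θ : AddCircle (2 * Real.pi))
    rw [hfα] at h1
    convert h1 using 1
    · funext n
      rw [fourier_coe_apply, smul_eq_mul]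
      congr 2
      have : (Real.pi : ℂ) ≠ 0 := by exact_mod_cast Real.pi_ne_zero
      push_cast
      field_simp
    · rw [← h0]
      rfl
  obtain ⟨b, hb'⟩ := exists_chebyshev_approx_of_hasSum hσ (D := 2 * C) (by positivity) (h := h)
    (a := fun n => (α n).re) (fun n => (Complex.abs_re_le_norm _).trans (hαb n)) (fun θ => by
      -- Since `h ∘ cos` is even, averaging over `θ` and `-θ` turns exponentials into cosines; real
      -- parts then give real coefficients.
      have h1 := ((hser θ).add (hser (-θ))).mul_left (1 / 2 : ℂ)
      rw [Real.cos_neg] at h1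
      have h2 := Complex.hasSum_re h1
      convert h2 using 1
      · funext n
        have : (1 / 2 : ℂ) * (α n * Complex.exp (n * θ * Complex.I) +
            α n * Complex.exp (n * ((-θ : ℝ) : ℂ) * Complex.I)) =
            α n * ((Real.cos (n * θ) : ℝ) : ℂ) := by
          rw [Complex.ofReal_cos, Complex.cos]
          push_cast
          ring_nf
        rw [this, Complex.re_mul_ofReal]
      · rw [← two_mul, ← mul_assoc]
        norm_num) p
  exact ⟨b, fun s hs => (hb' s hs).trans_eq (by ring)⟩

/-! ### Uniform Cauchy estimates -/

open scoped NNReal in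
theorem NNReal.tsum_sigma_fiber_le {ι : Type*} {β : ι → Type*} {f : (Σ i, β i) → ℝ≥0}
    (hf : Summable f) (i : ι) : ∑' s, f ⟨i, s⟩ ≤ ∑' s, f s :=
  NNReal.tsum_comp_le_tsum_of_inj hf sigma_mk_injective

open scoped NNReal ENNReal in
/-- Cauchy-type bounds on the directional derivatives of an analytic function near a point. -/
theorem AnalyticAt.exists_iteratedFDeriv_bound {E F : Type*} [NormedAddCommGroup E] [NormedSpace ℝ E]
    [NormedAddCommGroup F] [NormedSpace ℝ F] [CompleteSpace F] {G : E → F} {x : E} (hG : AnalyticAt ℝ G x) :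
    ∃ B : ℝ, ∀ᶠ y in 𝓝 x, ∀ (m : ℕ) (e : E), ‖e‖ ≤ 1 →
      ‖iteratedFDeriv ℝ m G y (fun _ => e)‖ ≤ B * m.factorial * B ^ m := by
  obtain ⟨q, r, hq⟩ := hG
  obtain ⟨ρ, hρ0, hρ⟩ := ENNReal.lt_iff_exists_nnreal_btwn.1 hq.r_pos
  have hρ0' : 0 < ρ := by exact_mod_cast hρ0
  -- Half the radius goes to moving the centre, half to the recentred series, so one double sum
  -- bounds all its coefficients.
  set t : ℝ≥0 := ρ / 2 with ht
  have ht0 : 0 < t := by positivity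
  have htt : (t + t : ℝ≥0∞) < q.radius := by
    rw [← ENNReal.coe_add, ht, add_halves]
    exact hρ.trans_le hq.r_le
  have hsum := q.changeOriginSeries_summable_aux₁ htt
  set B0 : ℝ≥0 := ∑' s : Σ k l : ℕ, { s : Finset (Fin (k + l)) // s.card = l },
    ‖q (s.1 + s.2.1)‖₊ * t ^ s.2.1 * t ^ s.1 with hB0
  have hbound (y : E) (hy : ‖y‖₊ ≤ t) (k : ℕ) : ‖q.changeOrigin y k‖₊ * t ^ k ≤ B0 := by
    have hyr : (‖y‖₊ : ℝ≥0∞) < q.radius :=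
      lt_of_le_of_lt (by exact_mod_cast hy) (lt_of_le_of_lt le_self_add htt)
    have hk := (NNReal.summable_sigma.1 hsum).1 k
    calc ‖q.changeOrigin y k‖₊ * t ^ k
        ≤ (∑' s : Σ l : ℕ, { s : Finset (Fin (k + l)) // s.card = l },
            ‖q (k + s.1)‖₊ * ‖y‖₊ ^ s.1) * t ^ k := by
          gcongr
          exact q.nnnorm_changeOrigin_le k hyr
      _ = ∑' s : Σ l : ℕ, { s : Finset (Fin (k + l)) // s.card = l },
            ‖q (k + s.1)‖₊ * ‖y‖₊ ^ s.1 * t ^ k := (NNReal.tsum_mul_right _ _).symm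
      _ ≤ ∑' s : Σ l : ℕ, { s : Finset (Fin (k + l)) // s.card = l },
            ‖q (k + s.1)‖₊ * t ^ s.1 * t ^ k := by
          have hle (s : Σ l : ℕ, { s : Finset (Fin (k + l)) // s.card = l }) :
              ‖q (k + s.1)‖₊ * ‖y‖₊ ^ s.1 * t ^ k ≤ ‖q (k + s.1)‖₊ * t ^ s.1 * t ^ k := by gcongr
          exact (NNReal.summable_of_le hle hk).tsum_le_tsum hle hk
      _ ≤ B0 := by
          exact NNReal.tsum_sigma_fiber_le hsum k
  refine ⟨max B0 (t⁻¹ : ℝ≥0), ?_⟩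
  filter_upwards [Metric.ball_mem_nhds x ht0] with y hy m e he
  rw [Metric.mem_ball, dist_eq_norm] at hy
  have hy' : ‖y - x‖₊ ≤ t := by exact_mod_cast hy.le
  have hyr : (‖y - x‖₊ : ℝ≥0∞) < r := by
    refine lt_of_le_of_lt ?_ hρ
    have : t ≤ ρ := by rw [ht]; exact half_le_self (zero_le (a := ρ))
    exact_mod_cast hy'.trans this
  have h1 := hq.changeOrigin hyr
  rw [add_sub_cancel] at h1
  rw [← h1.factorial_smul e m, ← Nat.cast_smul_eq_nsmul ℝ, norm_smul]
  have h2 : ‖q.changeOrigin (y - x) m (fun _ => e)‖ ≤ ‖q.changeOrigin (y - x) m‖ := by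
    refine ((q.changeOrigin (y - x) m).le_opNorm _).trans ?_
    refine mul_le_of_le_one_right (norm_nonneg _) ?_
    exact Finset.prod_le_one (fun _ _ => norm_nonneg _) fun _ _ => he
  have h3 : ‖q.changeOrigin (y - x) m‖ ≤ B0 * ((t⁻¹ : ℝ≥0) : ℝ) ^ m := by
    have : ‖q.changeOrigin (y - x) m‖ * (t : ℝ) ^ m ≤ B0 := by exact_mod_cast hbound _ hy' m
    rw [NNReal.coe_inv, inv_pow, ← div_eq_mul_inv, le_div_iff₀ (by positivity)]
    exact this
  calc _ ≤ (m.factorial : ℝ) * (B0 * ((t⁻¹ : ℝ≥0) : ℝ) ^ m) := by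
        rw [Real.norm_natCast]
        gcongr
        exact h2.trans h3
    _ = B0 * m.factorial * ((t⁻¹ : ℝ≥0) : ℝ) ^ m := by ring
    _ ≤ _ := by
      gcongr
      · exact le_max_left _ _
      · exact le_max_right _ _

/-- Cauchy-type bounds on the directional derivatives of an analytic function, uniform on a
compact set. -/
theorem AnalyticOnNhd.exists_iteratedFDeriv_bound {E F : Type*} [NormedAddCommGroup E] [NormedSpace ℝ E]
    [NormedAddCommGroup F] [NormedSpace ℝ F] [CompleteSpace F] {G : E → F} {K : Set E} (hK : IsCompact K) (hG : AnalyticOnNhd ℝ G K) :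
    ∃ B : ℝ, 0 < B ∧ ∀ y ∈ K, ∀ (m : ℕ) (e : E), ‖e‖ ≤ 1 →
      ‖iteratedFDeriv ℝ m G y (fun _ => e)‖ ≤ B * m.factorial * B ^ m := by
  refine hK.induction_on (p := fun K => ∃ B : ℝ, 0 < B ∧ ∀ y ∈ K, ∀ (m : ℕ) (e : E), ‖e‖ ≤ 1 →
      ‖iteratedFDeriv ℝ m G y (fun _ => e)‖ ≤ B * m.factorial * B ^ m) ⟨1, one_pos, by simp⟩
    (fun s t hst ⟨B, hB0, hB⟩ => ⟨B, hB0, fun y hy => hB y (hst hy)⟩)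
    (fun s t ⟨B, hB0, hB⟩ ⟨B', hB0', hB'⟩ => ⟨max B B', lt_max_of_lt_left hB0, ?_⟩) fun x hx => ?_
  · rintro y (hy | hy) m e he
    · refine (hB y hy m e he).trans ?_
      gcongr <;> exact le_max_left _ _
    · refine (hB' y hy m e he).trans ?_
      gcongr <;> exact le_max_right _ _
  · obtain ⟨B, hB⟩ := (hG x hx).exists_iteratedFDeriv_bound
    refine ⟨_, mem_nhdsWithin_of_mem_nhds hB, max |B| 1, by positivity, fun y hy m e he => ?_⟩
    refine (hy m e he).trans ?_
    have h1 : B ≤ max |B| 1 := (le_abs_self B).trans (le_max_left _ _)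
    calc B * m.factorial * B ^ m ≤ |B| * m.factorial * |B| ^ m := by
          rw [← abs_pow, mul_right_comm, mul_right_comm |B|, ← abs_mul]
          gcongr
          exact le_abs_self _
      _ ≤ _ := by gcongr <;> exact le_max_left _ _

/-- The iterated directional derivatives of a smooth function along a line are the successive
derivatives of its restriction to this line. -/
theorem hasDerivAt_iteratedFDeriv_line {E : Type*} [NormedAddCommGroup E] [NormedSpace ℝ E]
    {G : E → ℝ} (hG : ContDiff ℝ ⊤ G) (x e : E) (m : ℕ) (s : ℝ) :
    HasDerivAt (fun s : ℝ => iteratedFDeriv ℝ m G (x + s • e) (fun _ => e))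
      (iteratedFDeriv ℝ (m + 1) G (x + s • e) (fun _ => e)) s := by
  have hd : DifferentiableAt ℝ (iteratedFDeriv ℝ m G) (x + s • e) :=
    (hG.differentiable_iteratedFDeriv (by exact_mod_cast WithTop.coe_lt_top _)) _
  have hl : HasDerivAt (fun s : ℝ => x + s • e) e s := by
    simpa using ((hasDerivAt_id s).smul_const e).const_add x
  have h1 := hd.hasFDerivAt.comp_hasDerivAt s hl
  have h2 := ((ContinuousMultilinearMap.apply ℝ (fun _ : Fin m => E) ℝ (fun _ => e)).hasFDerivAt).comp_hasDerivAt s h1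
  rw [iteratedFDeriv_succ_apply_left]
  exact h2

/-! ### Approximation on the cube -/

/-- A polynomial factor is absorbed by weakening the rate of exponential decay. -/
theorem exists_polynomial_mul_pow_le (N : ℕ) {σ : ℝ} (hσ : σ ∈ Ioo (0 : ℝ) 1) :
    ∃ τ ∈ Ioo (0 : ℝ) 1, ∃ M : ℝ, ∀ p : ℕ, N * (2 * p + 3 : ℝ) ^ N * σ ^ p ≤ M * τ ^ p := by
  have hτ0 : 0 < √σ := Real.sqrt_pos.2 hσ.1
  have hτ1 : √σ < 1 := by rw [Real.sqrt_lt' one_pos]; simpa using hσ.2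
  obtain ⟨M, hM⟩ := (tendsto_pow_const_mul_const_pow_of_abs_lt_one N
    (by rwa [abs_of_pos hτ0] : |√σ| < 1)).bddAbove_range
  have hM' (k : ℕ) : (k : ℝ) ^ N * √σ ^ k ≤ M := hM ⟨k, rfl⟩
  -- One factor `√σ ^ p` absorbs the polynomial, the other is the new rate; `M / √σ` pays for
  -- replacing `p` by `p + 1`.
  refine ⟨√σ, ⟨hτ0, hτ1⟩, N * 3 ^ N * (M / √σ), fun p => ?_⟩
  have h1 : ((p : ℝ) + 1) ^ N * √σ ^ p ≤ M / √σ := by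
    rw [le_div_iff₀ hτ0, mul_assoc, ← pow_succ]
    exact_mod_cast hM' (p + 1)
  calc N * (2 * p + 3 : ℝ) ^ N * σ ^ p = N * (2 * p + 3 : ℝ) ^ N * (√σ * √σ) ^ p := by
        rw [Real.mul_self_sqrt hσ.1.le]
    _ ≤ N * (3 * ((p : ℝ) + 1)) ^ N * (√σ * √σ) ^ p := by
        gcongr
        linarith [(Nat.cast_nonneg p : (0 : ℝ) ≤ p)]
    _ = N * 3 ^ N * (((p : ℝ) + 1) ^ N * √σ ^ p) * √σ ^ p := by rw [mul_pow, mul_pow]; ring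
    _ ≤ _ := by gcongr

/-- A function that is real analytic on the cube is approximated exponentially fast by tensor
products of Chebyshev polynomials. -/
theorem exists_chebyshev_tensor_approx_of_analytic {N : ℕ} {F : (Fin N → ℝ) → ℝ}
    (hF : ∀ y : Fin N → ℝ, (∀ i, y i ∈ Icc (-1 : ℝ) 1) → AnalyticAt ℝ F y) :
    ∃ σ ∈ Ioo (0 : ℝ) 1, ∃ A : ℝ, ∀ p : ℕ, ∃ c : (Fin N → Fin (p + 1)) → ℝ,
      ∀ y : Fin N → ℝ, (∀ i, y i ∈ Icc (-1 : ℝ) 1) →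
        |F y - ∑ k, c k * ∏ j, (Polynomial.Chebyshev.T ℝ (k j : ℤ)).eval (y j)| ≤ A * σ ^ p := by
  set G : (Fin N → ℝ) → ℝ := fun θ => F fun i => Real.cos (θ i) with hGdef
  have hG (θ : Fin N → ℝ) : AnalyticAt ℝ G θ := by
    refine (hF (fun i => Real.cos (θ i)) fun i => ⟨Real.neg_one_le_cos _, Real.cos_le_one _⟩).fun_comp ?_
    rw [analyticAt_pi_iff]
    exact fun i => Real.analyticAt_cos.fun_comp
      ((ContinuousLinearMap.proj (R := ℝ) (φ := fun _ : Fin N => ℝ) i).analyticAt θ)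
  have hGs : ContDiff ℝ ⊤ G := AnalyticOnNhd.contDiff fun θ _ => hG θ
  obtain ⟨B, hB0, hB⟩ := AnalyticOnNhd.exists_iteratedFDeriv_bound (G := G)
    (isCompact_univ_pi fun _ : Fin N => isCompact_Icc (a := (0 : ℝ)) (b := 2 * Real.pi))
    fun θ _ => hG θ
  obtain ⟨σ, hσ, A, hA, happ⟩ := exists_chebyshev_approx_of_deriv_bound B hB0
  obtain ⟨τ, hτ, M, hM⟩ := exists_polynomial_mul_pow_le N hσ
  refine ⟨τ, hτ, B * A * M, fun p => ?_⟩
  have hσ0 := hσ.1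
  obtain ⟨c, hc⟩ := exists_chebyshev_tensor_approx p (B * A * σ ^ p) (by positivity) N F
    fun j y hy => by
      -- The other angles are frozen at `arccos (y i)`, inside the period box, so the same `B`
      -- serves every slice.
      set x : Fin N → ℝ := Function.update (fun i => Real.arccos (y i)) j 0 with hx
      have hline (s : ℝ) : x + s • Pi.single j (1 : ℝ) =
          Function.update (fun i => Real.arccos (y i)) j s := by
        funext i
        by_cases hi : i = j
        · subst hi; simp [hx]
        · simp [hx, hi]
      refine happ B (fun s => F (Function.update y j s))
        (fun m s => iteratedFDeriv ℝ m G (x + s • Pi.single j (1 : ℝ)) fun _ => Pi.single j 1)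
        (fun s => ?_) (fun m s => hasDerivAt_iteratedFDeriv_line hGs x _ m s)
        (fun m s hs => hB _ ?_ m _ ?_) p
      · rw [iteratedFDeriv_zero_apply, hline, hGdef]
        dsimp only
        congr 1
        funext i
        by_cases hi : i = j
        · subst hi; simp
        · simp [hi, Real.cos_arccos (hy i).1 (hy i).2]
      · rw [hline]
        intro i _
        by_cases hi : i = j
        · subst hi; simpa using hs
        · rw [Function.update_of_ne hi]
          exact ⟨Real.arccos_nonneg _, (Real.arccos_le_pi _).trans (by linarith [Real.pi_pos])⟩
      · rw [Pi.norm_single, norm_one]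
  refine ⟨c, fun y hy => (hc y hy).trans ?_⟩
  calc _ = B * A * (N * (2 * p + 3 : ℝ) ^ N * σ ^ p) := by ring
    _ ≤ B * A * (M * τ ^ p) := mul_le_mul_of_nonneg_left (hM p) (by positivity)
    _ = _ := by ring

/-! ### Choice of the degree and matrix form -/

/-- A finite family of exponential rates and constants has a common one. -/
theorem exists_uniform_exponential_bound {ι : Type*} [Finite ι] (σ A : ι → ℝ)
    (hσ : ∀ i, σ i ∈ Ioo (0 : ℝ) 1) :
    ∃ τ ∈ Ioo (0 : ℝ) 1, ∃ M : ℝ, 1 ≤ M ∧ ∀ i (p : ℕ), A i * σ i ^ p ≤ M * τ ^ p := by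
  have : Nonempty (Ioo (0 : ℝ) 1) := ⟨⟨1 / 2, by norm_num, by norm_num⟩⟩
  obtain ⟨τ, hτ⟩ := Finite.exists_le fun i => (⟨σ i, hσ i⟩ : Ioo (0 : ℝ) 1)
  obtain ⟨M, hM⟩ := Finite.exists_le A
  refine ⟨τ, τ.2, max M 1, le_max_right _ _, fun i p => ?_⟩
  have h0 := (hσ i).1
  have h1 : σ i ≤ τ := hτ i
  have h2 : A i ≤ max M 1 := (hM i).trans (le_max_left _ _)
  have h3 : 0 ≤ max M 1 := zero_le_one.trans (le_max_right _ _)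
  gcongr

/-- The smallest degrees that reach accuracy `ε` at an exponential rate grow logarithmically. -/
theorem exists_logarithmic_degree {σ : ℝ} (hσ : σ ∈ Ioo (0 : ℝ) 1) {A b : ℝ} (hA : 1 ≤ A)
    (hb : 0 < b) :
    ∃ p : ℝ → ℕ, (∀ ε, 0 < ε → b * (A * σ ^ p ε) ≤ ε) ∧
      (fun ε : ℝ => ((p ε + 1 : ℕ) : ℝ)) =O[𝓝[>] 0] fun ε : ℝ => Real.log (b / ε) := by
  have hL : 0 < -Real.log σ := neg_pos.2 (Real.log_neg hσ.1 hσ.2)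
  have hA0 : 0 < A := one_pos.trans_le hA
  have hσ0 := hσ.1
  refine ⟨fun ε => ⌈Real.log (b * A / ε) / -Real.log σ⌉₊, fun ε hε => ?_, ?_⟩
  · set p := ⌈Real.log (b * A / ε) / -Real.log σ⌉₊ with hp
    have h1 : Real.log (b * A / ε) ≤ p * -Real.log σ := (div_le_iff₀ hL).1 (Nat.le_ceil _)
    have h2 : Real.log (b * A / ε) ≤ Real.log ((σ ^ p)⁻¹) := by
      rw [Real.log_inv, Real.log_pow]
      linarith
    rw [Real.log_le_log_iff (by positivity) (by positivity), div_le_iff₀ hε,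
      inv_mul_eq_div, le_div_iff₀ (by positivity)] at h2
    rwa [← mul_assoc]
  · have hX : Tendsto (fun ε : ℝ => Real.log (b / ε)) (𝓝[>] 0) atTop :=
      Real.tendsto_log_atTop.comp ((tendsto_inv_nhdsGT_zero (𝕜 := ℝ)).const_mul_atTop hb)
    -- Once `X = log (b / ε) ≥ 1`, it absorbs `log A` and the two units from the ceiling and from `p
    -- + 1`.
    refine IsBigO.of_bound ((Real.log A + 1) / -Real.log σ + 2) ?_
    filter_upwards [hX.eventually_ge_atTop 1, self_mem_nhdsWithin] with ε hε hε0
    have hε0 : 0 < ε := hε0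
    have hlA : 0 ≤ Real.log A := Real.log_nonneg hA
    have h1 : Real.log (b * A / ε) = Real.log A + Real.log (b / ε) := by
      rw [← Real.log_mul hA0.ne' (by positivity)]
      congr 1
      ring
    rw [Real.norm_of_nonneg (by positivity), Real.norm_of_nonneg (zero_le_one.trans hε), h1]
    have h2 := Nat.ceil_lt_add_one
      (show 0 ≤ (Real.log A + Real.log (b / ε)) / -Real.log σ by
        have : 0 ≤ Real.log (b / ε) := zero_le_one.trans hε
        positivity)
    set X := Real.log (b / ε)
    have h3 : (Real.log A + X) / -Real.log σ ≤ (Real.log A + 1) / -Real.log σ * X := by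
      rw [div_mul_eq_mul_div]
      gcongr
      nlinarith
    push_cast
    nlinarith

/-- The product of a coefficient matrix with `B(x) ξ(t)` is a tensor Chebyshev expansion
in `(x, t)`. -/
theorem mul_chebB_mulVec_chebXi {n p : ℕ} {ι : Type*} (c : ι → (Fin (n + 1) → Fin (p + 1)) → ℝ)
    (x : EuclideanSpace ℝ (Fin n)) (t : ℝ) (a : ι) :
    (((Matrix.of fun a r => c a (finFunctionFinEquiv.symm r) :
        Matrix ι (Fin ((p + 1) ^ (n + 1))) ℝ) * chebB n p x) *ᵥ chebXi p t) a =
      ∑ k, c a k * ∏ j, (Polynomial.Chebyshev.T ℝ (k j : ℤ)).eval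
        ((Fin.snoc (fun i => x i) t : Fin (n + 1) → ℝ) j) := by
  rw [← Matrix.mulVec_mulVec]
  simp only [Matrix.mulVec, dotProduct, Matrix.of_apply, chebB, ite_mul, zero_mul,
    Finset.sum_ite_eq, Finset.mem_univ, if_true]
  rw [← finFunctionFinEquiv.symm.sum_comp]
  refine Finset.sum_congr rfl fun r _ => ?_
  simp [Fin.prod_univ_castSucc, chebProd, chebXi]

theorem corollary1 (n m : ℕ) (hn : 1 ≤ n)
    (D : Set (EuclideanSpace ℝ (Fin m)))
    (Δ : EuclideanSpace ℝ (Fin n) × EuclideanSpace ℝ (Fin m) → EuclideanSpace ℝ (Fin n))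
    (hΔ : ∀ i : Fin n, AnalyticOnNhd ℝ (fun z => Δ z i) (unitCube n ×ˢ D))
    (d : ℝ → EuclideanSpace ℝ (Fin m))
    (hd : AnalyticOnNhd ℝ d (Icc (-1 : ℝ) 1))
    (hdD : MapsTo d (Icc (-1 : ℝ) 1) D) :
    ∃ p : ℝ → ℕ,
      (∀ ε : ℝ, 0 < ε →
        ∃ Θ : Matrix (Fin n) (Fin ((p ε + 1) ^ (n + 1))) ℝ,
          ∀ x ∈ unitCube n, ∀ t ∈ Icc (-1 : ℝ) 1,
            ‖Δ (x, d t) - WithLp.toLp 2 ((Θ * chebB n (p ε) x) *ᵥ chebXi (p ε) t)‖ ≤ ε) ∧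
      (fun ε : ℝ => (((p ε + 1) ^ (n + 1) : ℕ) : ℝ)) =O[𝓝[>] 0]
        (fun ε : ℝ => Real.log (Real.sqrt n / ε) ^ (n + 1)) ∧
      (fun ε : ℝ => ((p ε + 1 : ℕ) : ℝ)) =O[𝓝[>] 0]
        (fun ε : ℝ => Real.log (Real.sqrt n / ε)) := by
  set L : (Fin (n + 1) → ℝ) →L[ℝ] EuclideanSpace ℝ (Fin n) :=
    ((EuclideanSpace.equiv (Fin n) ℝ).symm : (Fin n → ℝ) →L[ℝ] EuclideanSpace ℝ (Fin n)) ∘L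
      ContinuousLinearMap.pi fun i => ContinuousLinearMap.proj (R := ℝ) (φ := fun _ : Fin (n + 1) => ℝ) i.castSucc with hL
  have hLa (y : Fin (n + 1) → ℝ) (i : Fin n) : L y i = y i.castSucc := rfl
  -- Time becomes the last variable, matching the top digit of the row number.
  set F : Fin n → (Fin (n + 1) → ℝ) → ℝ := fun a y => Δ (L y, d (y (Fin.last n))) a with hF
  have hFan (a : Fin n) (y : Fin (n + 1) → ℝ) (hy : ∀ i, y i ∈ Icc (-1 : ℝ) 1) :
      AnalyticAt ℝ (F a) y := by
    have h1 : AnalyticAt ℝ (fun y : Fin (n + 1) → ℝ => (L y, d (y (Fin.last n)))) y :=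
      (L.analyticAt y).prod (AnalyticAt.fun_comp (f := fun y : Fin (n + 1) → ℝ => y (Fin.last n))
        (hd _ (hy _)) ((ContinuousLinearMap.proj (R := ℝ) (φ := fun _ : Fin (n + 1) => ℝ) (Fin.last n)).analyticAt y))
    exact AnalyticAt.fun_comp (f := fun y : Fin (n + 1) → ℝ => (L y, d (y (Fin.last n))))
      (hΔ a (L y, d (y (Fin.last n))) ⟨fun i => hy _, hdD (hy _)⟩) h1
  choose σ hσ A hA using fun a => exists_chebyshev_tensor_approx_of_analytic (hFan a)
  obtain ⟨τ, hτ, M, hM1, hM⟩ := exists_uniform_exponential_bound σ A hσ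
  -- `b = √n` converts the componentwise bound into the Euclidean one.
  obtain ⟨p, hp, hO⟩ := exists_logarithmic_degree hτ hM1
    (Real.sqrt_pos.2 (by exact_mod_cast hn : (0 : ℝ) < n))
  refine ⟨p, fun ε hε => ?_, ?_, hO⟩
  · choose c hc using fun a => hA a (p ε)
    refine ⟨Matrix.of fun a r => c a (finFunctionFinEquiv.symm r), fun x hx t ht => ?_⟩
    refine le_trans ?_ (hp ε hε)
    have hτ0 := hτ.1
    have hM0 : 0 < M := one_pos.trans_le hM1
    set y : Fin (n + 1) → ℝ := Fin.snoc (fun i => x i) t with hy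
    have hyc : ∀ i, y i ∈ Icc (-1 : ℝ) 1 :=
      Fin.lastCases (by simpa [hy] using ht) fun i => by simpa [hy] using hx i
    have hFy (a : Fin n) : F a y = Δ (x, d t) a := by
      have h1 : L y = x := by ext i; simp [hLa, hy]
      have h2 : y (Fin.last n) = t := by simp [hy]
      rw [hF]
      dsimp only
      rw [h1, h2]
    rw [EuclideanSpace.norm_eq]
    calc _ ≤ √(∑ _a : Fin n, (M * τ ^ p ε) ^ 2) := by
          refine Real.sqrt_le_sqrt (Finset.sum_le_sum fun a _ => ?_)
          refine pow_le_pow_left₀ (norm_nonneg _) ?_ 2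
          rw [PiLp.sub_apply, ← hFy, Real.norm_eq_abs]
          dsimp only
          rw [mul_chebB_mulVec_chebXi c]
          exact (hc a y hyc).trans (hM a _)
      _ = _ := by
          rw [Finset.sum_const, Finset.card_univ, Fintype.card_fin, nsmul_eq_mul,
            Real.sqrt_mul (by positivity), Real.sqrt_sq (by positivity)]
  · simpa only [Nat.cast_pow] using hO.pow (n + 1)
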